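/- Let $\mathcal H$ be a real Hilbert space with inner product $\langle\cdot,\cdot\rangle$ and norm $\|\cdot\|$, let $\varphi\colon\mathcal H\to\left]-\infty,+\infty\right]$ be proper, convex and lower semicontinuous, let $T\colon\mathcal H\to\mathcal H$ be any map, and define $f\colon\mathcal H\to\left]-\infty,+\infty\right]$ by $f(x)=\varphi(Tx)+\tfrac12\|x-Tx\|^2$. Write $\operatorname{Prox}_\varphi$ for the proximity operator of $\varphi$ ($\operatorname{Prox}_\varphi(x)$ is the unique minimizer over $y\in\mathcal H$ of $\varphi(y)+\tfrac12\|x-y\|^2$), $\operatorname{env}\varphi$ for its Moreau envelope, $(\operatorname{env}\varphi)(x)=\inf_{y\in\mathcal H}\bigl(\varphi(y)+\tfrac12\|x-y\|^2\bigr)$, $\operatorname{ran}T$ for the range of $T$, $\iota_C$ for the function equal to $0$ on $C$ and $+\infty$ elsewhere, and $\operatorname{gra}\psi=\{(x,\xi)\in\mathcal H\times\mathbb R:\psi(x)=\xi\}$ for the graph of $\psi\colon\mathcal H\to\left]-\infty,+\infty\right]$. Then the following are equivalent: (i) $T=\operatorname{Prox}_\varphi$. (ii) $T$ is monotone (that is,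 $\langle x-y,Tx-Ty\rangle\ge0$ for all $x,y\in\mathcal H$), $\operatorname{gra}(\varphi+\iota_{\operatorname{ran}T})$ is a dense subset of $\operatorname{gra}\varphi$ (in the norm topology of $\mathcal H\times\mathbb R$), and $f$ is real-valued and Gâteaux differentiable on $\mathcal H$ with $\nabla f(x)=x-Tx$ for every $x\in\mathcal H$. Furthermore, if (i) or (ii) holds, then $f=\operatorname{env}\varphi$ and $f$ is real-valued and Fréchet differentiable on $\mathcal H$. -/

import Mathlib

namespace ProxOp

noncomputable section

variable {H : Type*} [NormedAddCommGroup H] [InnerProductSpace ℝ H]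

/-- The function `q = (1/2) ‖·‖²`. -/
def q (x : H) : ℝ := (1 / 2) * ‖x‖ ^ 2

/-- The class `Γ₀(H)`: proper, convex, lower semicontinuous functions from `H` to `]-∞, +∞]`.
Convexity of an extended-real-valued function is convexity of its epigraph in `H × ℝ`. -/
structure IsGammaZero (φ : H → EReal) : Prop where
  ne_bot : ∀ x, φ x ≠ ⊥
  exists_ne_top : ∃ x, φ x ≠ ⊤
  convex_epigraph : Convex ℝ {p : H × ℝ | φ p.1 ≤ (p.2 : EReal)}
  lowerSemicontinuous : LowerSemicontinuous φ

open scoped Classical in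
/-- The indicator function `ι_C`: `0` on `C` and `+∞` off `C`. -/
def indicatorFn (C : Set H) (x : H) : EReal := if x ∈ C then 0 else ⊤

/-- The graph of an extended-real-valued function, a subset of `H × ℝ`. -/
def gra (φ : H → EReal) : Set (H × ℝ) := {p | φ p.1 = (p.2 : EReal)}

/-- `A` is a dense subset of `B`. -/
def IsDenseSubset {X : Type*} [TopologicalSpace X] (A B : Set X) : Prop :=
  A ⊆ B ∧ B ⊆ closure A

/-- Monotonicity of an operator on `H`. -/
def IsMonotoneOp (T : H → H) : Prop := ∀ x y : H, 0 ≤ inner ℝ (x - y) (T x - T y)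

/-- The Moreau envelope: the infimal convolution of `φ` and `q`. -/
def env (φ : H → EReal) (x : H) : EReal := ⨅ y : H, (φ y + ((q (x - y) : ℝ) : EReal))

/-- `p` minimizes `y ↦ φ y + (1/2) ‖x - y‖²` over `H`. -/
def IsProxPoint (φ : H → EReal) (x p : H) : Prop :=
  ∀ y : H, φ p + ((q (x - p) : ℝ) : EReal) ≤ φ y + ((q (x - y) : ℝ) : EReal)

/-- The proximity operator: `prox φ x` is the minimizer of `y ↦ φ y + (1/2) ‖x - y‖²`
(which exists and is unique for `φ ∈ Γ₀(H)`, `H` a Hilbert space). -/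
def prox (φ : H → EReal) (x : H) : H := Classical.epsilon (IsProxPoint φ x)

/-- `f` is (finite and) Gâteaux differentiable on `H`, with gradient `G`: at every `x` and in
every direction `v` the directional derivative is `⟪G x, v⟫`. -/
def HasGateauxGradient (f : H → EReal) (G : H → H) : Prop :=
  ∃ g : H → ℝ, (∀ x, f x = (g x : EReal)) ∧
    ∀ x v : H, HasLineDerivAt ℝ g (inner ℝ (G x) v) x v

/-- `f` is (finite and) Fréchet differentiable on `H`. -/
def IsFrechetDifferentiable (f : H → EReal) : Prop :=
  ∃ g : H → ℝ, (∀ x, f x = (g x : EReal)) ∧ Differentiable ℝ g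

end

end ProxOp

namespace ProxOp

variable {H : Type*} [NormedAddCommGroup H] [InnerProductSpace ℝ H]

/-! For `φ` in `Γ₀(H)`, `p = prox φ x` exactly when `x - p` is a subgradient of `φ` at `p`.
Subgradient inequalities give monotonicity and confine the first-order remainder of `env φ` between
`0` and `½‖y - x‖²`. Minimizers of `φ + c q(x - ·)` lie in the range of `prox φ` and, for `c` large,
approximate `(x, φ x)` in the graph. Conversely, `q - f` has line derivatives given by the monotone
`T`, so it lies above its tangents (`IsMonotoneOp.add_inner_le`). Expanded, this says that `T x`
minimizes `φ + q(x - ·)` over `ran T`; density of the graph extends this to all of `H`. -/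

/-- `u` is a subgradient of `φ` at `p`, where `φ` takes the finite value `r`. -/
def HasSubgradient (φ : H → EReal) (p u : H) (r : ℝ) : Prop :=
  φ p = r ∧ ∀ (y : H) (s : ℝ), φ y ≤ s → r + inner ℝ u (y - p) ≤ s

theorem q_sub (a b : H) : q (a - b) = q a - inner ℝ a b + q b := by
  simp only [q, norm_sub_sq_real]; ring

theorem q_smul (t : ℝ) (a : H) : q (t • a) = t ^ 2 * q a := by
  simp only [q, norm_smul, mul_pow, Real.norm_eq_abs, sq_abs]; ring

omit [InnerProductSpace ℝ H] in
theorem q_nonneg (a : H) : 0 ≤ q a := by unfold q; positivity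

omit [InnerProductSpace ℝ H] in
theorem continuous_q : Continuous (q : H → ℝ) := by unfold q; fun_prop

/-! ### Minimizers and subgradients of functions in `Γ₀(H)`. -/

namespace IsGammaZero

variable {φ : H → EReal}

theorem exists_real (hφ : IsGammaZero φ) {x : H} (hx : φ x ≠ ⊤) : ∃ r : ℝ, φ x = r :=
  ⟨(φ x).toReal, (EReal.coe_toReal hx (hφ.ne_bot x)).symm⟩

theorem segment_le (hφ : IsGammaZero φ) {x y : H} {a b t : ℝ} (hx : φ x ≤ a) (hy : φ y ≤ b)
    (h0 : 0 ≤ t) (h1 : t ≤ 1) : φ (x + t • (y - x)) ≤ ((1 - t) * a + t * b : ℝ) := by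
  have h := hφ.convex_epigraph (x := (x, a)) hx (y := (y, b)) hy (a := 1 - t) (b := t)
    (by linarith) h0 (by ring)
  have e : x + t • (y - x) = (1 - t) • x + t • y := by module
  rw [e]
  simpa using h

theorem exists_ball_gt (hφ : IsGammaZero φ) {x : H} {r ε : ℝ} (hx : φ x = r) (hε : 0 < ε) :
    ∃ δ > 0, ∀ y, ‖y - x‖ < δ → ((r - ε : ℝ) : EReal) < φ y := by
  have h := hφ.lowerSemicontinuous x ((r - ε : ℝ) : EReal)
    (show ((r - ε : ℝ) : EReal) < φ x by rw [hx]; exact EReal.coe_lt_coe_iff.2 (by linarith))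
  obtain ⟨δ, hδ, hb⟩ := Metric.eventually_nhds_iff.1 h
  exact ⟨δ, hδ, fun y hy => hb (by rwa [dist_eq_norm])⟩

/-- Near `x` this is lower semicontinuity; a far point with too low a value would, by convexity,
force too low a value inside the ball. -/
theorem exists_linear_minorant (hφ : IsGammaZero φ) {x : H} {r : ℝ} (hx : φ x = r) :
    ∃ K : ℝ, 0 ≤ K ∧ ∀ (y : H) (s : ℝ), φ y ≤ s → r - 1 - K * ‖y - x‖ ≤ s := by
  obtain ⟨δ, hδ, hb⟩ := hφ.exists_ball_gt hx one_pos
  refine ⟨2 / δ, by positivity, fun y s hs => ?_⟩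
  by_cases hd : ‖y - x‖ < δ
  · have h1 := EReal.coe_lt_coe_iff.1 ((hb y hd).trans_le hs)
    have : 0 ≤ 2 / δ * ‖y - x‖ := by positivity
    linarith
  · push Not at hd
    have hd0 : 0 < ‖y - x‖ := hδ.trans_le hd
    set t := δ / (2 * ‖y - x‖) with ht
    have ht0 : 0 < t := by positivity
    have ht1 : t ≤ 1 := by rw [ht, div_le_one (by positivity)]; linarith
    have hn : t * ‖y - x‖ = δ / 2 := by rw [ht]; field_simp
    have h1 := hφ.segment_le hx.le hs ht0.le ht1
    have h2 := hb (x + t • (y - x)) (by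
      rw [add_sub_cancel_left, norm_smul, Real.norm_eq_abs, abs_of_pos ht0, hn]; linarith)
    have h3 := EReal.coe_lt_coe_iff.1 (h2.trans_le h1)
    have h4 : t * (r - s) < t * (2 / δ * ‖y - x‖) := by
      have : t * (2 / δ * ‖y - x‖) = 1 := by
        rw [mul_left_comm, hn]; field_simp
      rw [this]; linarith
    have := lt_of_mul_lt_mul_left h4 ht0.le
    linarith

theorem le_of_tendsto (hφ : IsGammaZero φ) {y : ℕ → H} {s : ℕ → ℝ} {p : H} {r : ℝ}
    (hy : Filter.Tendsto y Filter.atTop (nhds p)) (hs : Filter.Tendsto s Filter.atTop (nhds r))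
    (h : ∀ n, φ (y n) ≤ s n) : φ p ≤ r := by
  have hc := hφ.lowerSemicontinuous.isClosed_epigraph
  exact hc.mem_of_tendsto
    (hy.prodMk_nhds ((continuous_coe_real_ereal.tendsto r).comp hs)) (Filter.Eventually.of_forall h)

theorem exists_le_add_q (hφ : IsGammaZero φ) (x : H) {c : ℝ} (hc : 0 < c) :
    ∃ m : ℝ, ∀ (y : H) (s : ℝ), φ y ≤ s → m ≤ s + c * q (x - y) := by
  obtain ⟨x₀, hx₀⟩ := hφ.exists_ne_top
  obtain ⟨r, hr⟩ := hφ.exists_real hx₀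
  obtain ⟨K, hK, hb⟩ := hφ.exists_linear_minorant hr
  refine ⟨r - 1 - K * ‖x - x₀‖ - K ^ 2 / (2 * c), fun y s hs => ?_⟩
  have h1 := hb y s hs
  have h2 : ‖y - x₀‖ ≤ ‖x - y‖ + ‖x - x₀‖ := by
    rw [norm_sub_rev x y]; simpa using norm_add_le (y - x) (x - x₀)
  have h3 := mul_le_mul_of_nonneg_left h2 hK
  have h4 : K * ‖x - y‖ ≤ c * q (x - y) + K ^ 2 / (2 * c) := by
    have : c * q (x - y) + K ^ 2 / (2 * c) - K * ‖x - y‖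
        = (c * ‖x - y‖ - K) ^ 2 / (2 * c) := by
      unfold q; field_simp; ring
    have : 0 ≤ (c * ‖x - y‖ - K) ^ 2 / (2 * c) := by positivity
    linarith
  linarith

/-- The function `φ + c q(x - ·)` attains its minimum. -/
theorem exists_minimizer [CompleteSpace H] (hφ : IsGammaZero φ) (x : H) {c : ℝ} (hc : 0 < c) :
    ∃ (p : H) (r : ℝ), φ p = r ∧
      ∀ (y : H) (s : ℝ), φ y ≤ s → r + c * q (x - p) ≤ s + c * q (x - y) := by
  let S : Set ℝ := {v | ∃ (y : H) (s : ℝ), φ y ≤ s ∧ s + c * q (x - y) = v}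
  have hne : S.Nonempty := by
    obtain ⟨x₀, hx₀⟩ := hφ.exists_ne_top
    obtain ⟨r, hr⟩ := hφ.exists_real hx₀
    exact ⟨_, x₀, r, hr.le, rfl⟩
  have hbdd : BddBelow S := by
    obtain ⟨m, hm⟩ := hφ.exists_le_add_q x hc
    exact ⟨m, by rintro _ ⟨y, s, h, rfl⟩; exact hm y s h⟩
  set m := sInf S
  have hm : ∀ (y : H) (s : ℝ), φ y ≤ s → m ≤ s + c * q (x - y) :=
    fun y s h => csInf_le hbdd ⟨y, s, h, rfl⟩
  have hseq : ∀ n : ℕ, ∃ (y : H) (s : ℝ), φ y ≤ s ∧ s + c * q (x - y) < m + 1 / ((n : ℝ) + 1) := by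
    intro n
    obtain ⟨_, ⟨y, s, h, rfl⟩, hlt⟩ := exists_lt_of_csInf_lt hne
      (show sInf S < m + 1 / ((n : ℝ) + 1) from lt_add_of_pos_right _ (by positivity))
    exact ⟨y, s, h, hlt⟩
  choose y s hys hlt using hseq
  -- The parallelogram law at the midpoint makes the minimizing sequence Cauchy.
  have hdist : ∀ n k, c / 4 * ‖y n - y k‖ ^ 2 ≤ 1 / ((n : ℝ) + 1) + 1 / ((k : ℝ) + 1) := by
    intro n k
    have h1 := hm _ _ (hφ.segment_le (hys n) (hys k) (t := 1 / 2) (by norm_num) (by norm_num))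
    have h2 : q (x - (y n + (1 / 2 : ℝ) • (y k - y n)))
        = (q (x - y n) + q (x - y k)) / 2 - ‖y n - y k‖ ^ 2 / 8 := by
      have e1 : x - (y n + (1 / 2 : ℝ) • (y k - y n))
          = (1 / 2 : ℝ) • ((x - y n) + (x - y k)) := by module
      have e2 : y n - y k = (x - y k) - (x - y n) := by abel
      have hp := parallelogram_law_with_norm ℝ (x - y k) (x - y n)
      rw [e1, q_smul, e2, add_comm]
      simp only [q]
      nlinarith
    rw [h2] at h1
    have h3 := hlt n
    have h4 := hlt k
    nlinarith
  have hcauchy : CauchySeq y := by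
    refine Metric.cauchySeq_iff'.2 fun ε hε => ?_
    obtain ⟨N, hN⟩ := exists_nat_one_div_lt (show 0 < c / 8 * ε ^ 2 by positivity)
    refine ⟨N, fun n hn => ?_⟩
    have h1 : 1 / ((n : ℝ) + 1) ≤ 1 / ((N : ℝ) + 1) := Nat.one_div_le_one_div hn
    have h2 := hdist n N
    rw [dist_eq_norm]
    refine lt_of_pow_lt_pow_left₀ 2 hε.le ?_
    have : c / 4 * ‖y n - y N‖ ^ 2 < c / 4 * ε ^ 2 := by linarith
    exact lt_of_mul_lt_mul_left this (by positivity)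
  obtain ⟨p, hp⟩ := cauchySeq_tendsto_of_complete hcauchy
  have hv : Filter.Tendsto (fun n => s n + c * q (x - y n)) Filter.atTop (nhds m) := by
    refine tendsto_of_tendsto_of_tendsto_of_le_of_le tendsto_const_nhds ?_
      (fun n => hm _ _ (hys n)) (fun n => (hlt n).le)
    simpa using (tendsto_one_div_add_atTop_nhds_zero_nat (𝕜 := ℝ)).const_add m
  have hq : Filter.Tendsto (fun n => c * q (x - y n)) Filter.atTop (nhds (c * q (x - p))) :=
    ((continuous_q.tendsto _).comp (hp.const_sub x)).const_mul c
  have hs : Filter.Tendsto s Filter.atTop (nhds (m - c * q (x - p))) := by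
    simpa using hv.sub hq
  have hle := hφ.le_of_tendsto hp hs hys
  obtain ⟨r, hr⟩ := hφ.exists_real (hle.trans_lt (EReal.coe_lt_top _)).ne
  have hrm : r ≤ m - c * q (x - p) := by rw [hr] at hle; exact EReal.coe_le_coe_iff.1 hle
  refine ⟨p, r, hr, fun z t hz => ?_⟩
  have := hm z t hz
  linarith

/-- First-order condition at a minimizer `p`: compare with `p + t (y - p)`, divide by `t`, and let
`t` be small. -/
theorem exists_hasSubgradient [CompleteSpace H] (hφ : IsGammaZero φ) (x : H) {c : ℝ} (hc : 0 < c) :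
    ∃ (p : H) (r : ℝ), HasSubgradient φ p (c • (x - p)) r := by
  obtain ⟨p, r, hr, hmin⟩ := hφ.exists_minimizer x hc
  refine ⟨p, r, hr, fun y s hs => ?_⟩
  have key : ∀ t : ℝ, 0 < t → t ≤ 1 →
      c * inner ℝ (x - p) (y - p) ≤ s - r + t * (c * q (y - p)) := by
    intro t h0 h1
    have h := hmin _ _ (hφ.segment_le hr.le hs h0.le h1)
    rw [← sub_sub, q_sub (x - p), inner_smul_right, q_smul] at h
    have : t * (c * inner ℝ (x - p) (y - p)) ≤ t * (s - r + t * (c * q (y - p))) := by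
      linarith
    exact le_of_mul_le_mul_left this h0
  rw [inner_smul_left]
  simp only [conj_trivial]
  by_contra! hcon
  have hB : 0 ≤ c * q (y - p) := mul_nonneg hc.le (q_nonneg _)
  set A := r + c * inner ℝ (x - p) (y - p) - s with hA
  have hA0 : 0 < A := by linarith
  set B := c * q (y - p)
  -- In place of a limit, one explicit `t ≤ 1` with `t * B < A` contradicts `key`.
  have h := key (A / (A + B + 1)) (by positivity) (by rw [div_le_one (by positivity)]; linarith)
  have h2 : A / (A + B + 1) * B < A := by
    rw [div_mul_eq_mul_div, div_lt_iff₀ (by positivity)]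
    nlinarith
  linarith

end IsGammaZero

/-! ### Subgradients characterize prox points. -/

namespace HasSubgradient

variable {φ : H → EReal}

/-- The surplus `q (y - p)` comes from strong convexity; it yields both minimality and uniqueness.
-/
theorem add_q_le {x p y : H} {r s : ℝ} (h : HasSubgradient φ p (x - p) r) (hy : φ y ≤ s) :
    r + q (x - p) + q (y - p) ≤ s + q (x - y) := by
  have h1 := h.2 y s hy
  have e : x - y = (x - p) - (y - p) := by abel
  rw [e, q_sub (x - p)]
  linarith

theorem isProxPoint (hφ : IsGammaZero φ) {x p : H} {r : ℝ} (h : HasSubgradient φ p (x - p) r) :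
    IsProxPoint φ x p := by
  intro y
  by_cases hy : φ y = ⊤
  · rw [hy, EReal.top_add_coe]; exact le_top
  · obtain ⟨s, hs⟩ := hφ.exists_real hy
    rw [hs, h.1, ← EReal.coe_add, ← EReal.coe_add, EReal.coe_le_coe_iff]
    have := h.add_q_le hs.le
    have := q_nonneg (y - p)
    linarith

theorem eq_of_isProxPoint (hφ : IsGammaZero φ) {x p p' : H} {r : ℝ}
    (h : HasSubgradient φ p (x - p) r) (h' : IsProxPoint φ x p') : p' = p := by
  have h1 := h' p
  have htop : φ p' ≠ ⊤ := by
    intro ht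
    rw [ht, h.1, EReal.top_add_coe, ← EReal.coe_add, top_le_iff] at h1
    exact EReal.coe_ne_top _ h1
  obtain ⟨s, hs⟩ := hφ.exists_real htop
  rw [hs, h.1, ← EReal.coe_add, ← EReal.coe_add, EReal.coe_le_coe_iff] at h1
  have h2 := h.add_q_le hs.le
  have h3 : q (p' - p) ≤ 0 := by linarith
  unfold q at h3
  have h4 : ‖p' - p‖ ^ 2 = 0 := le_antisymm (by linarith) (by positivity)
  exact sub_eq_zero.1 (norm_eq_zero.1 (pow_eq_zero_iff two_ne_zero |>.1 h4))

theorem prox_eq (hφ : IsGammaZero φ) {x p : H} {r : ℝ} (h : HasSubgradient φ p (x - p) r) :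
    prox φ x = p :=
  h.eq_of_isProxPoint hφ (Classical.epsilon_spec ⟨p, h.isProxPoint hφ⟩)

theorem inner_nonneg {p p' u u' : H} {r r' : ℝ} (h : HasSubgradient φ p u r)
    (h' : HasSubgradient φ p' u' r') : 0 ≤ inner ℝ (u - u') (p - p') := by
  have h1 := h.2 p' r' h'.1.le
  have h2 := h'.2 p r h.1.le
  simp only [inner_sub_left, inner_sub_right] at *
  linarith

end HasSubgradient

/-! ### Monotonicity, dense graph and envelope gradient for `prox φ`. -/

variable {φ : H → EReal}

theorem IsGammaZero.hasSubgradient_prox [CompleteSpace H] (hφ : IsGammaZero φ) (x : H) :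
    ∃ r : ℝ, HasSubgradient φ (prox φ x) (x - prox φ x) r := by
  obtain ⟨p, r, h⟩ := hφ.exists_hasSubgradient x one_pos
  rw [one_smul] at h
  rw [h.prox_eq hφ]
  exact ⟨r, h⟩

theorem IsGammaZero.eq_prox_of_isProxPoint [CompleteSpace H] (hφ : IsGammaZero φ) {x p : H}
    (h : IsProxPoint φ x p) : p = prox φ x := by
  obtain ⟨r, hr⟩ := hφ.hasSubgradient_prox x
  exact hr.eq_of_isProxPoint hφ h

theorem IsGammaZero.isMonotoneOp_prox [CompleteSpace H] (hφ : IsGammaZero φ) :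
    IsMonotoneOp (prox φ) := by
  intro x y
  obtain ⟨r, hx⟩ := hφ.hasSubgradient_prox x
  obtain ⟨s, hy⟩ := hφ.hasSubgradient_prox y
  have h := hx.inner_nonneg hy
  have e : x - prox φ x - (y - prox φ y) = (x - y) - (prox φ x - prox φ y) := by abel
  rw [e, inner_sub_left] at h
  have := real_inner_self_nonneg (x := prox φ x - prox φ y)
  linarith

theorem mem_gra_add_indicatorFn (hφ : IsGammaZero φ) (C : Set H) (p : H × ℝ) :
    p ∈ gra (fun x => φ x + indicatorFn C x) ↔ p.1 ∈ C ∧ p ∈ gra φ := by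
  by_cases h : p.1 ∈ C
  · simp [gra, indicatorFn, h]
  · simp [gra, indicatorFn, h, EReal.add_top_of_ne_bot (hφ.ne_bot _), (EReal.coe_ne_top _).symm]

theorem IsGammaZero.isDenseSubset_gra_prox [CompleteSpace H] (hφ : IsGammaZero φ) :
    IsDenseSubset (gra (fun x => φ x + indicatorFn (Set.range (prox φ)) x)) (gra φ) := by
  refine ⟨fun p hp => ((mem_gra_add_indicatorFn hφ _ p).1 hp).2, ?_⟩
  rintro ⟨x, r⟩ (hx : φ x = r)
  refine Metric.mem_closure_iff.2 fun ε hε => ?_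
  obtain ⟨δ, hδ, hball⟩ := hφ.exists_ball_gt hx hε
  obtain ⟨K, hK, hb⟩ := hφ.exists_linear_minorant hx
  set η := min δ ε
  have hη : 0 < η := lt_min hδ hε
  -- Chosen so that `d ≥ η` implies `c d² > 1 + K d`, while `h1` and `h2` give the reverse
  -- inequality for `d = ‖p - x‖`.
  set c := 1 / η ^ 2 + K / η + 1 with hc
  have hc0 : 0 < c := by positivity
  obtain ⟨p, s, h⟩ := hφ.exists_hasSubgradient x hc0
  have h1 := h.2 x r hx.le
  have h2 := hb p s h.1.le
  rw [inner_smul_left, real_inner_self_eq_norm_sq, conj_trivial, norm_sub_rev] at h1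
  have hd : ‖p - x‖ < η := by
    by_contra! hge
    have hd0 : 0 < ‖p - x‖ := hη.trans_le hge
    have h3 : c * ‖p - x‖ ^ 2 ≤ 1 + K * ‖p - x‖ := by linarith
    have h4 : 1 ≤ 1 / η ^ 2 * ‖p - x‖ ^ 2 := by
      rw [one_div_mul_eq_div, one_le_div (by positivity)]; gcongr
    have h5 : K * ‖p - x‖ ≤ K / η * ‖p - x‖ ^ 2 := by
      have : 1 ≤ ‖p - x‖ / η := (one_le_div hη).2 hge
      calc K * ‖p - x‖ = K * ‖p - x‖ * 1 := (mul_one _).symm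
        _ ≤ K * ‖p - x‖ * (‖p - x‖ / η) := by gcongr
        _ = K / η * ‖p - x‖ ^ 2 := by ring
    have h6 : 0 < ‖p - x‖ ^ 2 := by positivity
    rw [hc] at h3
    linarith
  have hmem : p ∈ Set.range (prox φ) := by
    refine ⟨p + c • (x - p), HasSubgradient.prox_eq hφ (r := s) ?_⟩
    rwa [add_sub_cancel_left]
  refine ⟨(p, s), (mem_gra_add_indicatorFn hφ _ _).2 ⟨hmem, h.1⟩, ?_⟩
  have h7 := hball p (hd.trans_le (min_le_left _ _))
  rw [h.1, EReal.coe_lt_coe_iff] at h7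
  have h8 : 0 ≤ c * ‖p - x‖ ^ 2 := by positivity
  rw [Prod.dist_eq, max_lt_iff]
  refine ⟨?_, ?_⟩
  · rw [dist_comm, dist_eq_norm]; exact hd.trans_le (min_le_right _ _)
  · rw [Real.dist_eq, abs_lt]; constructor <;> linarith

theorem IsGammaZero.env_eq [CompleteSpace H] (hφ : IsGammaZero φ) (x : H) :
    env φ x = φ (prox φ x) + ((q (x - prox φ x) : ℝ) : EReal) := by
  obtain ⟨r, h⟩ := hφ.hasSubgradient_prox x
  exact le_antisymm (iInf_le _ _) (le_iInf (h.isProxPoint hφ))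

/-- The Moreau envelope is real-valued and Fréchet differentiable with gradient `Id - prox φ`. -/
theorem IsGammaZero.exists_hasGradientAt_env [CompleteSpace H] (hφ : IsGammaZero φ) :
    ∃ g : H → ℝ, (∀ x, env φ x = (g x : EReal)) ∧
      ∀ x, HasGradientAt g (x - prox φ x) x := by
  choose r hr using hφ.hasSubgradient_prox
  refine ⟨fun x => r x + q (x - prox φ x), fun x => ?_, fun x => ?_⟩
  · rw [hφ.env_eq, (hr x).1, EReal.coe_add]
  rw [hasGradientAt_iff_isLittleO]
  refine Asymptotics.IsBigO.trans_isLittleO (g := fun y => ‖y - x‖ ^ 2) ?_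
    (Asymptotics.isLittleO_pow_sub_sub x one_lt_two)
  refine Asymptotics.isBigO_of_le _ fun y => ?_
  -- `h1` bounds the remainder above by `½‖y - x‖²`; `h2` with `h4` bounds it below by `0`.
  have h1 := (hr y).add_q_le (hr x).1.le
  have h2 := (hr x).2 _ _ (hr y).1.le
  have h3 := q_nonneg (prox φ x - prox φ y)
  have h4 := q_nonneg ((x - prox φ x) - (y - prox φ y))
  have e1 : y - prox φ x = (x - prox φ x) - (x - y) := by abel
  have e2 : prox φ y - prox φ x = (y - x) + ((x - prox φ x) - (y - prox φ y)) := by abel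
  have e3 : q (x - y) = (1 / 2) * ‖y - x‖ ^ 2 := by rw [q, norm_sub_rev]
  have e4 : inner ℝ (x - prox φ x) (x - y) = -inner ℝ (x - prox φ x) (y - x) := by
    rw [← inner_neg_right, neg_sub]
  have e5 : inner ℝ (x - prox φ x) (x - prox φ x) = 2 * q (x - prox φ x) := by
    rw [real_inner_self_eq_norm_sq, q]; ring
  rw [e1, q_sub (x - prox φ x), e3, e4] at h1
  rw [e2, inner_add_right, inner_sub_right _ (x - prox φ x), e5] at h2
  rw [q_sub (x - prox φ x)] at h4
  have h5 : 0 ≤ ‖y - x‖ ^ 2 := by positivity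
  rw [Real.norm_eq_abs, Real.norm_eq_abs, abs_of_nonneg h5, abs_le]
  constructor <;> linarith

/-! ### From the gradient formula back to `T = prox φ`. -/

/-- A function whose line derivatives are given by a monotone operator lies above its tangents. -/
theorem IsMonotoneOp.add_inner_le {T : H → H} (hT : IsMonotoneOp T) {g : H → ℝ}
    (hg : ∀ x v : H, HasLineDerivAt ℝ g (inner ℝ (T x) v) x v) (x y : H) :
    g x + inner ℝ (T x) (y - x) ≤ g y := by
  set v := y - x with hv
  have hder : ∀ t : ℝ, HasDerivAt (fun t : ℝ => g (x + t • v)) (inner ℝ (T (x + t • v)) v) t := by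
    intro t
    have h := hg (x + t • v) v
    unfold HasLineDerivAt at h
    have h' := HasDerivAt.comp_sub_const t t (by simpa using h)
    refine h'.congr_of_eventuallyEq (Filter.Eventually.of_forall fun u => ?_)
    simp only [add_assoc, ← add_smul]
    congr 3
    ring
  -- The slope on the segment is the derivative at some `t > 0`, which monotonicity compares with
  -- the one at `0`.
  obtain ⟨t, ht, he⟩ := exists_hasDerivAt_eq_slope (fun t : ℝ => g (x + t • v)) _ zero_lt_one
    (fun t _ => (hder t).continuousAt.continuousWithinAt) (fun t _ => hder t)
  have h1 := hT (x + t • v) x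
  rw [add_sub_cancel_left, inner_smul_left, conj_trivial, inner_sub_right,
    real_inner_comm, real_inner_comm (T x)] at h1
  have h2 := nonneg_of_mul_nonneg_right h1 ht.1
  have e : x + (1 : ℝ) • v = y := by rw [hv]; module
  rw [e] at he
  simp only [zero_smul, add_zero, sub_zero, div_one] at he
  linarith

theorem hasLineDerivAt_q (x v : H) : HasLineDerivAt ℝ q (inner ℝ x v) x v := by
  have h : HasFDerivAt (q : H → ℝ) _ x :=
    (hasStrictFDerivAt_norm_sq x).hasFDerivAt.const_mul (1 / 2 : ℝ)
  have h' := h.hasLineDerivAt v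
  simpa using h'

/-- The inequality cuts out a closed set of pairs `(z, s)`, so it passes to the closure of the
restricted graph. -/
theorem IsGammaZero.isProxPoint_of_le_on_dense (hφ : IsGammaZero φ) {C : Set H}
    (hd : gra φ ⊆ closure (gra (fun x => φ x + indicatorFn C x))) {x p : H} {r : ℝ}
    (hr : φ p = r)
    (h : ∀ (z : H) (s : ℝ), z ∈ C → φ z = s → r + q (x - p) ≤ s + q (x - z)) :
    IsProxPoint φ x p := by
  intro y
  by_cases hy : φ y = ⊤
  · rw [hy, EReal.top_add_coe]; exact le_top
  obtain ⟨s, hs⟩ := hφ.exists_real hy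
  rw [hs, hr, ← EReal.coe_add, ← EReal.coe_add, EReal.coe_le_coe_iff]
  have hcl : IsClosed {w : H × ℝ | r + q (x - p) ≤ w.2 + q (x - w.1)} := by
    refine isClosed_le continuous_const ?_
    exact continuous_snd.add (continuous_q.comp (continuous_const.sub continuous_fst))
  have hsub : gra (fun x => φ x + indicatorFn C x) ⊆
      {w : H × ℝ | r + q (x - p) ≤ w.2 + q (x - w.1)} := by
    intro w hw
    obtain ⟨h1, h2⟩ := (mem_gra_add_indicatorFn hφ C w).1 hw
    exact h w.1 w.2 h1 h2
  exact closure_minimal hsub hcl (hd (show (y, s) ∈ gra φ from hs))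

theorem IsGammaZero.eq_prox [CompleteSpace H] (hφ : IsGammaZero φ) {T : H → H} {f : H → EReal}
    (hf : ∀ x, f x = φ (T x) + ((q (x - T x) : ℝ) : EReal)) (hT : IsMonotoneOp T)
    (hd : gra φ ⊆ closure (gra (fun x => φ x + indicatorFn (Set.range T) x)))
    (hG : HasGateauxGradient f (fun x => x - T x)) : T = prox φ := by
  obtain ⟨g, hg, hder⟩ := hG
  have hfin : ∀ x, φ (T x) = ((g x - q (x - T x) : ℝ) : EReal) := by
    intro x
    have h1 := (hg x).symm.trans (hf x)
    have htop : φ (T x) ≠ ⊤ := by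
      intro ht
      rw [ht, EReal.top_add_coe] at h1
      exact EReal.coe_ne_top _ h1
    obtain ⟨r, hr⟩ := hφ.exists_real htop
    rw [hr, ← EReal.coe_add, EReal.coe_eq_coe_iff] at h1
    rw [hr, h1, add_sub_cancel_right]
  have hconv : ∀ x y, (q x - g x) + inner ℝ (T x) (y - x) ≤ q y - g y := by
    refine hT.add_inner_le (g := fun x => q x - g x) fun x v => ?_
    have h := HasDerivAt.sub (hasLineDerivAt_q x v) (hder x v)
    rw [← inner_sub_left, sub_sub_cancel] at h
    exact h
  funext x
  refine hφ.eq_prox_of_isProxPoint (hφ.isProxPoint_of_le_on_dense hd (hfin x) ?_)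
  rintro _ s ⟨y, rfl⟩ hs
  rw [hfin y, EReal.coe_eq_coe_iff] at hs
  -- Substituting `g y = φ (T y) + q (y - T y)` turns the tangent inequality at `y` into `g x ≤ φ (T
  -- y) + q (x - T y)`.
  have h := hconv y x
  rw [← hs]
  simp only [q_sub, inner_sub_right] at *
  have e : inner ℝ (T y) y = inner ℝ y (T y) := real_inner_comm _ _
  have e' : inner ℝ (T y) x = inner ℝ x (T y) := real_inner_comm _ _
  linarith

end ProxOp

theorem theoremt {H : Type*} [NormedAddCommGroup H] [InnerProductSpace ℝ H] [CompleteSpace H]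
    (φ : H → EReal) (hφ : ProxOp.IsGammaZero φ) (T : H → H)
    (f : H → EReal) (hf : ∀ x, f x = φ (T x) + ((ProxOp.q (x - T x) : ℝ) : EReal)) :
    (T = ProxOp.prox φ ↔
      (ProxOp.IsMonotoneOp T ∧
        ProxOp.IsDenseSubset
          (ProxOp.gra (fun x => φ x + ProxOp.indicatorFn (Set.range T) x)) (ProxOp.gra φ) ∧
        ProxOp.HasGateauxGradient f (fun x => x - T x))) ∧
    ((T = ProxOp.prox φ ∨
      (ProxOp.IsMonotoneOp T ∧
        ProxOp.IsDenseSubset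
          (ProxOp.gra (fun x => φ x + ProxOp.indicatorFn (Set.range T) x)) (ProxOp.gra φ) ∧
        ProxOp.HasGateauxGradient f (fun x => x - T x))) →
      f = ProxOp.env φ ∧ ProxOp.IsFrechetDifferentiable f) := by

  have forward : T = ProxOp.prox φ → f = ProxOp.env φ := by
    rintro rfl
    funext x
    rw [hf, hφ.env_eq]
  obtain ⟨g, hg, hgrad⟩ := hφ.exists_hasGradientAt_env
  have equiv : T = ProxOp.prox φ ↔
      (ProxOp.IsMonotoneOp T ∧
        ProxOp.IsDenseSubset
          (ProxOp.gra (fun x => φ x + ProxOp.indicatorFn (Set.range T) x)) (ProxOp.gra φ) ∧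
        ProxOp.HasGateauxGradient f (fun x => x - T x)) := by
    constructor
    · intro hT
      have he := forward hT
      subst hT
      refine ⟨hφ.isMonotoneOp_prox, hφ.isDenseSubset_gra_prox, g, fun x => by rw [he, hg], ?_⟩
      intro x v
      exact (hgrad x).hasFDerivAt.hasLineDerivAt v
    · rintro ⟨h1, h2, h3⟩
      exact hφ.eq_prox hf h1 h2.2 h3
  refine ⟨equiv, fun h => ?_⟩
  have he := forward (h.elim id equiv.2)
  exact ⟨he, g, fun x => by rw [he, hg], fun x => (hgrad x).hasFDerivAt.differentiableAt⟩
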